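/- Let $\mathbb{H}^2_{\mathbb{C}}$ be the complex hyperbolic plane, that is, the unit ball of $\mathbb{C}^2$ with the Bergman distance $d$ given by $\cosh^2\big(d(z,w)/2\big)=\frac{|\langle Z,W\rangle|^2}{\langle Z,Z\rangle\langle W,W\rangle}$, where $\langle Z,W\rangle = Z_0\overline{W_0}+Z_1\overline{W_1}-Z_2\overline{W_2}$, $Z=(z_0,z_1,1)$ and $W=(w_0,w_1,1)$; the group $PU(2,1)$ acts on it by fractional linear transformations. Let $\mathcal{H}=\mathbb{C}\times\mathbb{R}$ be the Heisenberg group with the product $(\xi,v)(\xi',v')=(\xi+\xi',\,v+v'+2\,\mathrm{Im}(\xi\overline{\xi'}))$, embedded in $PU(2,1)$ by $$(\xi,v)\longmapsto\begin{pmatrix}1&\xi&\xi\\ -\bar\xi&1-\tfrac12(|\xi|^2-iv)&-\tfrac12(|\xi|^2-iv)\\ \bar\xi&\tfrac12(|\xi|^2-iv)&1+\tfrac12(|\xi|^2-iv)\end{pmatrix}.$$ **Theorem 3.2.** Let $G\subset PU(2,1)$ be a (necessarily discrete and parabolic) group that is conjugate in $PU(2,1)$ to the subgroup $\Gamma=\{(m,n)\in\mathbb{C}\times\mathbb{R}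 : m,n\in\mathbb{Z}\}$ of $\mathcal{H}$. Then for every center $y\in\mathbb{H}^2_{\mathbb{C}}$ the Dirichlet polyhedron $$D_y(G)=\{x\in\mathbb{H}^2_{\mathbb{C}} : d(x,y)\le d(x,gy)\text{ for all } g\in G\}$$ has infinitely many sides. Here, for $g\in G$ with $gy\ne y$, the set $S=D_y(G)\cap\{x : d(x,y)=d(x,gy)\}$ is a side of $D_y(G)$ if it has codimension one, that is, if it contains a nonempty relatively open subset of the bisector $\{x : d(x,y)=d(x,gy)\}$. -/

import Mathlib

open scoped Matrix ComplexConjugate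

namespace CHyp

/-- The diagonal matrix of the Hermitian form of signature `(2,1)` on `ℂ³`. -/
def J : Matrix (Fin 3) (Fin 3) ℂ := Matrix.diagonal ![1, 1, -1]

/-- The Hermitian form `⟨Z, W⟩ = Z₀ W̄₀ + Z₁ W̄₁ - Z₂ W̄₂` of signature `(2,1)` on `ℂ³`. -/
def herm (Z W : Fin 3 → ℂ) : ℂ := Z 0 * conj (W 0) + Z 1 * conj (W 1) - Z 2 * conj (W 2)

/-- The complex hyperbolic plane, as the open unit ball of `ℂ²` (with the Euclidean norm). -/
def CH2 : Type := {z : EuclideanSpace ℂ (Fin 2) // z ∈ Metric.ball 0 1}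

/-- The topology of the ball, as a subspace of `ℂ²`. -/
instance : TopologicalSpace CH2 :=
  inferInstanceAs (TopologicalSpace {z : EuclideanSpace ℂ (Fin 2) // z ∈ Metric.ball 0 1})

/-- The standard lift `(z₀, z₁, 1) ∈ ℂ³` of a point `(z₀, z₁)` of the ball. -/
def CH2.lift (z : CH2) : Fin 3 → ℂ := ![z.1 0, z.1 1, 1]

/-- The Bergman distance on the ball, normalised so that the sectional curvature lies between
`-1` and `-1/4`: `cosh² (d(z,w) / 2) = |⟨Z, W⟩|² / (⟨Z, Z⟩ ⟨W, W⟩)` for lifts `Z`, `W` of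
`z`, `w`. -/
noncomputable def bergmanDist (z w : CH2) : ℝ :=
  2 * Real.arcosh (‖herm z.lift w.lift‖ /
    Real.sqrt ((herm z.lift z.lift).re * (herm w.lift w.lift).re))

/-- The group `U(2,1)` of complex matrices that preserve the Hermitian form. -/
def U21 : Subgroup (GL (Fin 3) ℂ) where
  carrier := {A | (A : Matrix (Fin 3) (Fin 3) ℂ)ᴴ * J * (A : Matrix (Fin 3) (Fin 3) ℂ) = J}
  one_mem' := by simp
  mul_mem' := by
    intro A B hA hB
    simp only [Set.mem_ofPred_eq, Units.val_mul, Matrix.conjTranspose_mul] at *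
    calc _ = (B : Matrix (Fin 3) (Fin 3) ℂ)ᴴ * ((A : Matrix (Fin 3) (Fin 3) ℂ)ᴴ * J *
              (A : Matrix (Fin 3) (Fin 3) ℂ)) * (B : Matrix (Fin 3) (Fin 3) ℂ) := by
            simp only [Matrix.mul_assoc]
      _ = J := by rw [hA, hB]
  inv_mem' := by
    intro A hA
    simp only [Set.mem_ofPred_eq] at *
    have h1 : (A : Matrix (Fin 3) (Fin 3) ℂ) * ((A⁻¹ : GL (Fin 3) ℂ) : Matrix _ _ ℂ) = 1 :=
      A.mul_inv
    have h2 : ((A⁻¹ : GL (Fin 3) ℂ) : Matrix (Fin 3) (Fin 3) ℂ)ᴴ *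
        (A : Matrix (Fin 3) (Fin 3) ℂ)ᴴ = 1 := by
      rw [← Matrix.conjTranspose_mul, h1, Matrix.conjTranspose_one]
    calc _ = ((A⁻¹ : GL (Fin 3) ℂ) : Matrix (Fin 3) (Fin 3) ℂ)ᴴ *
              ((A : Matrix (Fin 3) (Fin 3) ℂ)ᴴ * J * (A : Matrix (Fin 3) (Fin 3) ℂ)) *
              ((A⁻¹ : GL (Fin 3) ℂ) : Matrix (Fin 3) (Fin 3) ℂ) := by rw [hA]
      _ = (((A⁻¹ : GL (Fin 3) ℂ) : Matrix (Fin 3) (Fin 3) ℂ)ᴴ *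
              (A : Matrix (Fin 3) (Fin 3) ℂ)ᴴ) * J * ((A : Matrix (Fin 3) (Fin 3) ℂ) *
              ((A⁻¹ : GL (Fin 3) ℂ) : Matrix (Fin 3) (Fin 3) ℂ)) := by
            simp only [Matrix.mul_assoc]
      _ = J := by rw [h1, h2, Matrix.one_mul, Matrix.mul_one]

/-- The underlying matrix of an element of `U(2,1)`. -/
def umat (A : U21) : Matrix (Fin 3) (Fin 3) ℂ := ((A : GL (Fin 3) ℂ) : Matrix _ _ ℂ)

theorem umat_one : umat 1 = 1 := rfl

theorem umat_mul (A B : U21) : umat (A * B) = umat A * umat B := rfl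

theorem umat_injective : Function.Injective umat := fun _ _ h =>
  Subtype.ext (Units.ext h)

theorem umat_mem (A : U21) : (umat A)ᴴ * J * umat A = J := A.2

theorem herm_eq (Z W : Fin 3 → ℂ) : herm Z W = star W ⬝ᵥ (J *ᵥ Z) := by
  simp [herm, J, dotProduct, Fin.sum_univ_three, Matrix.mulVec_diagonal]
  ring

theorem herm_mulVec (A : U21) (Z W : Fin 3 → ℂ) :
    herm (umat A *ᵥ Z) (umat A *ᵥ W) = herm Z W := by
  rw [herm_eq, herm_eq, Matrix.star_mulVec, ← Matrix.dotProduct_mulVec, Matrix.mulVec_mulVec,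
    Matrix.mulVec_mulVec, umat_mem A]

theorem herm_self_re (Z : Fin 3 → ℂ) :
    (herm Z Z).re = ‖Z 0‖ ^ 2 + ‖Z 1‖ ^ 2 - ‖Z 2‖ ^ 2 := by
  simp only [herm, Complex.mul_conj, Complex.normSq_eq_norm_sq, Complex.sub_re, Complex.add_re,
    Complex.ofReal_re]

theorem mem_ball_iff (z : EuclideanSpace ℂ (Fin 2)) :
    z ∈ Metric.ball (0 : EuclideanSpace ℂ (Fin 2)) 1 ↔ ‖z 0‖ ^ 2 + ‖z 1‖ ^ 2 < 1 := by
  rw [mem_ball_zero_iff, ← Fin.sum_univ_two (fun i => ‖z i‖ ^ 2), ← EuclideanSpace.norm_sq_eq,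
    sq_lt_one_iff₀ (norm_nonneg _)]

theorem CH2.herm_lift_neg (z : CH2) : (herm z.lift z.lift).re < 0 := by
  have h := (mem_ball_iff z.1).1 z.2
  rw [herm_self_re]
  simp only [CH2.lift, Matrix.cons_val]
  simp
  linarith

theorem coord_two_ne_zero {Z : Fin 3 → ℂ} (h : (herm Z Z).re < 0) : Z 2 ≠ 0 := by
  intro h0
  rw [herm_self_re, h0] at h
  simp at h
  nlinarith [sq_nonneg ‖Z 0‖, sq_nonneg ‖Z 1‖]

/-- The point `(Z₀ / Z₂, Z₁ / Z₂)` of the ball that corresponds to the complex line spanned by a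
negative vector `Z`. -/
noncomputable def CH2.ofNeg (Z : Fin 3 → ℂ) (h : (herm Z Z).re < 0) : CH2 :=
  ⟨!₂[Z 0 / Z 2, Z 1 / Z 2], by
    have h2 := coord_two_ne_zero h
    have h3 : 0 < ‖Z 2‖ ^ 2 := by positivity
    rw [herm_self_re] at h
    rw [mem_ball_iff]
    simp only [Matrix.cons_val, norm_div, div_pow]
    rw [← add_div, div_lt_one h3]
    linarith⟩

theorem CH2.lift_ofNeg (Z : Fin 3 → ℂ) (h : (herm Z Z).re < 0) :
    (CH2.ofNeg Z h).lift = (Z 2)⁻¹ • Z := by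
  have h2 := coord_two_ne_zero h
  funext i
  fin_cases i <;> simp [CH2.lift, CH2.ofNeg, div_eq_inv_mul, h2]

theorem CH2.ofNeg_smul (c : ℂ) (Z W : Fin 3 → ℂ) (hZ : (herm Z Z).re < 0)
    (hW : (herm W W).re < 0) (h : W = c • Z) : CH2.ofNeg W hW = CH2.ofNeg Z hZ := by
  have hc : c ≠ 0 := by
    rintro rfl
    exact coord_two_ne_zero hW (by simp [h])
  apply Subtype.ext
  subst h
  ext i
  fin_cases i <;> simp [CH2.ofNeg, mul_div_mul_left _ _ hc]

theorem CH2.ofNeg_lift (z : CH2) : CH2.ofNeg z.lift z.herm_lift_neg = z := by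
  apply Subtype.ext
  ext i
  fin_cases i <;> simp [CH2.ofNeg, CH2.lift]

theorem neg_mulVec (A : U21) (z : CH2) :
    (herm (umat A *ᵥ z.lift) (umat A *ᵥ z.lift)).re < 0 := by
  rw [herm_mulVec]
  exact z.herm_lift_neg

/-- The action of `U(2,1)` on the ball by fractional linear transformations. -/
noncomputable instance : MulAction U21 CH2 where
  smul A z := CH2.ofNeg (umat A *ᵥ z.lift) (neg_mulVec A z)
  one_smul z := by
    refine (CH2.ofNeg_smul 1 z.lift _ z.herm_lift_neg _ ?_).trans z.ofNeg_lift
    rw [umat_one, Matrix.one_mulVec, one_smul]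
  mul_smul A B z := by
    refine (CH2.ofNeg_smul (((umat B *ᵥ z.lift) 2)⁻¹) _ _ (neg_mulVec (A * B) z)
      (neg_mulVec A (CH2.ofNeg (umat B *ᵥ z.lift) (neg_mulVec B z))) ?_).symm
    rw [CH2.lift_ofNeg, Matrix.mulVec_smul, Matrix.mulVec_mulVec, umat_mul]

theorem U21.smul_def (A : U21) (z : CH2) :
    A • z = CH2.ofNeg (umat A *ᵥ z.lift) (neg_mulVec A z) := rfl

/-- The subgroup of scalar matrices in `U(2,1)`. -/
def scalars : Subgroup U21 where
  carrier := {A | ∃ c : ℂ, umat A = c • (1 : Matrix (Fin 3) (Fin 3) ℂ)}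
  one_mem' := ⟨1, by rw [umat_one, one_smul]⟩
  mul_mem' := by
    rintro A B ⟨a, ha⟩ ⟨b, hb⟩
    exact ⟨a * b, by rw [umat_mul, ha, hb, Matrix.smul_mul, Matrix.one_mul, smul_smul]⟩
  inv_mem' := by
    rintro A ⟨a, ha⟩
    have h1 : umat A * umat A⁻¹ = 1 := by rw [← umat_mul, mul_inv_cancel, umat_one]
    rw [ha, Matrix.smul_mul, Matrix.one_mul] at h1
    have h0 : a ≠ 0 := by
      rintro rfl
      have := congrFun (congrFun h1 0) 0
      simp at this
    exact ⟨a⁻¹, by rw [← h1, smul_smul, inv_mul_cancel₀ h0, one_smul]⟩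

instance : scalars.Normal where
  conj_mem := by
    rintro A ⟨a, ha⟩ B
    refine ⟨a, ?_⟩
    rw [umat_mul, umat_mul, ha, Matrix.mul_smul, Matrix.mul_one, Matrix.smul_mul,
      ← umat_mul, mul_inv_cancel, umat_one]

/-- The projective unitary group `PU(2,1)`. -/
abbrev PU21 : Type := U21 ⧸ scalars

theorem scalars_smul (A : U21) (hA : A ∈ scalars) (z : CH2) : A • z = z := by
  obtain ⟨a, ha⟩ := hA
  refine (CH2.ofNeg_smul a z.lift _ z.herm_lift_neg (neg_mulVec A z) ?_).trans z.ofNeg_lift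
  rw [ha, Matrix.smul_mulVec, Matrix.one_mulVec]

/-- The action of `PU(2,1)` on the ball, induced by that of `U(2,1)`. -/
noncomputable instance : MulAction PU21 CH2 :=
  MulAction.compHom CH2 (QuotientGroup.lift scalars (MulAction.toPermHom U21 CH2)
    (fun A hA => Equiv.ext (scalars_smul A hA)))

theorem PU21.mk_smul (A : U21) (z : CH2) : (QuotientGroup.mk A : PU21) • z = A • z := rfl

/-- The Heisenberg group `ℂ × ℝ`. -/
@[ext] structure Heis where
  /-- the horizontal coordinate -/
  xi : ℂ
  /-- the vertical (central) coordinate -/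
  v : ℝ

/-- The group law `(ξ, v) (ξ', v') = (ξ + ξ', v + v' + 2 Im (ξ ξ̄'))`. -/
noncomputable instance : Group Heis where
  mul p q := ⟨p.xi + q.xi, p.v + q.v + 2 * (p.xi * conj q.xi).im⟩
  one := ⟨0, 0⟩
  inv p := ⟨-p.xi, -p.v⟩
  mul_assoc p q r := by
    apply Heis.ext
    · exact add_assoc _ _ _
    · change p.v + q.v + 2 * (p.xi * conj q.xi).im + r.v + 2 * ((p.xi + q.xi) * conj r.xi).im =
        p.v + (q.v + r.v + 2 * (q.xi * conj r.xi).im) + 2 * (p.xi * conj (q.xi + r.xi)).im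
      simp
      ring
  one_mul p := by
    apply Heis.ext
    · exact zero_add _
    · change 0 + p.v + 2 * (0 * conj p.xi).im = p.v
      simp
  mul_one p := by
    apply Heis.ext
    · exact add_zero _
    · change p.v + 0 + 2 * (p.xi * conj 0).im = p.v
      simp
  inv_mul_cancel p := by
    apply Heis.ext
    · exact neg_add_cancel _
    · change -p.v + p.v + 2 * (-p.xi * conj p.xi).im = 0
      simp [mul_comm]

theorem Heis.mul_def (p q : Heis) :
    p * q = ⟨p.xi + q.xi, p.v + q.v + 2 * (p.xi * conj q.xi).im⟩ := rfl

theorem Heis.one_def : (1 : Heis) = ⟨0, 0⟩ := rfl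

theorem Heis.inv_def (p : Heis) : p⁻¹ = ⟨-p.xi, -p.v⟩ := rfl

/-- The complex number `(|ξ|² - i v) / 2`. -/
noncomputable def Heis.half (p : Heis) : ℂ := (p.xi * conj p.xi - Complex.I * p.v) / 2

/-- The matrix of the Heisenberg translation by `(ξ, v)`. It fixes the null vector
`(0, 1, -1)`, which represents the boundary point `∞`. -/
noncomputable def Heis.mat (p : Heis) : Matrix (Fin 3) (Fin 3) ℂ :=
  !![1, p.xi, p.xi;
     -conj p.xi, 1 - p.half, -p.half;
     conj p.xi, p.half, 1 + p.half]

theorem Heis.mat_one : Heis.mat 1 = 1 := by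
  ext i j
  fin_cases i <;> fin_cases j <;> simp [Heis.mat, Heis.half, Heis.one_def]

theorem Heis.half_mul (p q : Heis) :
    (p * q).half = p.half + q.half + conj p.xi * q.xi := by
  have h : (((p.xi * conj q.xi).im : ℝ) : ℂ) =
      (p.xi * conj q.xi - conj p.xi * q.xi) / (2 * Complex.I) := by
    rw [Complex.im_eq_sub_conj]
    simp
  simp only [Heis.half, Heis.mul_def, Complex.ofReal_add, Complex.ofReal_mul,
    Complex.ofReal_ofNat, h, map_add]
  field_simp
  ring

theorem Heis.mat_mul (p q : Heis) : (p * q).mat = p.mat * q.mat := by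
  have h1 : (p * q).xi = p.xi + q.xi := rfl
  ext i j
  fin_cases i <;> fin_cases j <;>
    simp [Heis.mat, Heis.half_mul, h1, Matrix.mul_apply, Fin.sum_univ_three] <;> ring

theorem Heis.mat_mem (p : Heis) : p.matᴴ * J * p.mat = J := by
  have h : conj p.half = p.xi * conj p.xi - p.half := by
    simp only [Heis.half, map_div₀, map_sub, map_mul, Complex.conj_conj, Complex.conj_I,
      Complex.conj_ofReal, Complex.conj_ofNat]
    ring
  ext i j
  fin_cases i <;> fin_cases j <;>
    simp [Heis.mat, J, Matrix.mul_apply, Fin.sum_univ_three, Matrix.diagonal, h] <;> ring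

/-- The embedding of the Heisenberg group in `U(2,1)`. -/
noncomputable def Heis.toU21 : Heis →* U21 where
  toFun p := ⟨⟨p.mat, p⁻¹.mat, by rw [← Heis.mat_mul, mul_inv_cancel, Heis.mat_one],
    by rw [← Heis.mat_mul, inv_mul_cancel, Heis.mat_one]⟩, p.mat_mem⟩
  map_one' := umat_injective Heis.mat_one
  map_mul' p q := umat_injective (Heis.mat_mul p q)

/-- The Heisenberg group as a group of elements of `PU(2,1)`. -/
noncomputable def Heis.toPU21 : Heis →* PU21 := (QuotientGroup.mk' scalars).comp Heis.toU21

/-- The integer lattice `{(m, n) : m, n ∈ ℤ}` in the Heisenberg group `ℂ × ℝ`. -/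
def integerLattice : Subgroup Heis where
  carrier := {p | ∃ m n : ℤ, p = ⟨(m : ℂ), (n : ℝ)⟩}
  one_mem' := ⟨0, 0, by simp [Heis.one_def]⟩
  mul_mem' := by
    rintro _ _ ⟨m, n, rfl⟩ ⟨m', n', rfl⟩
    exact ⟨m + m', n + n', by simp [Heis.mul_def]⟩
  inv_mem' := by
    rintro _ ⟨m, n, rfl⟩
    exact ⟨-m, -n, by simp [Heis.inv_def]⟩

/-- The Dirichlet polyhedron of `G` centered at `y`. -/
def dirichlet (G : Subgroup PU21) (y : CH2) : Set CH2 :=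
  {x | ∀ g ∈ G, bergmanDist x y ≤ bergmanDist x (g • y)}

/-- The bisector of two points. -/
def bisector (y w : CH2) : Set CH2 := {x | bergmanDist x y = bergmanDist x w}

/-- `S` is a side of the Dirichlet polyhedron of `G` centered at `y`: the part of the polyhedron
that lies in the bisector of `y` and another point `g y` of its orbit, provided that this part has
codimension one, that is, contains a nonempty relatively open piece of the bisector (which is a
smooth real hypersurface). -/
def IsSide (G : Subgroup PU21) (y : CH2) (S : Set CH2) : Prop :=
  ∃ g ∈ G, g • y ≠ y ∧ S = dirichlet G y ∩ bisector y (g • y) ∧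
    ∃ U : Set CH2, IsOpen U ∧ (U ∩ bisector y (g • y)).Nonempty ∧ U ∩ bisector y (g • y) ⊆ S

end CHyp

namespace CHyp

/-! After undoing the conjugation, the squared modulus of the Hermitian product of `x` with the
translate of `y` by `(m, n)` is, up to a factor independent of `(m, n)`, `((p - m)^2 + R)^2 + (τ - m
* β + n)^2` with `R ≥ 0` (`norm_herm_heis_sq`, `coordR_nonneg`). Distances from `x` to the orbit are
ordered by this form.

The term `m * β` is the twist of the Heisenberg product: it shears the column `m = 1` vertically by
an amount that depends on `x`, and for a fixed center `y` it takes every real value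
(`exists_point`). At `p = 1/2`, `τ = 0`, `β = n`, the columns `m = 0` and `m = 1` are equally near,
and their minima are at `(0, 0)` and `(1, n)` only. All other columns are farther by a definite
margin, so near such a point the bisector of `y` and its translate by `(1, n)` stays inside the
polyhedron (`orbitForm_le`). Each integer `n` thus gives a side, and the chosen points tell these
sides apart (`exists_side_point`). -/

theorem herm_smul_right (c : ℂ) (Z W : Fin 3 → ℂ) : herm Z (c • W) = conj c * herm Z W := by
  simp [herm]
  ring

theorem herm_smul_left (c : ℂ) (Z W : Fin 3 → ℂ) : herm (c • Z) W = c * herm Z W := by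
  simp [herm]
  ring

/-- Two negative vectors are never orthogonal. -/
theorem herm_ne_zero {Z W : Fin 3 → ℂ} (hZ : (herm Z Z).re < 0) (hW : (herm W W).re < 0) :
    herm Z W ≠ 0 := by
  intro h
  rw [herm_self_re] at hZ hW
  have h1 : Z 0 * conj (W 0) + Z 1 * conj (W 1) = Z 2 * conj (W 2) := sub_eq_zero.1 h
  have h2 : ‖Z 2‖ * ‖W 2‖ ≤ ‖Z 0‖ * ‖W 0‖ + ‖Z 1‖ * ‖W 1‖ := by
    have := norm_add_le (Z 0 * conj (W 0)) (Z 1 * conj (W 1))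
    rw [h1] at this
    simpa using this
  have h3 : (‖Z 0‖ * ‖W 0‖ + ‖Z 1‖ * ‖W 1‖) ^ 2 ≤
      (‖Z 0‖ ^ 2 + ‖Z 1‖ ^ 2) * (‖W 0‖ ^ 2 + ‖W 1‖ ^ 2) := by
    nlinarith [sq_nonneg (‖Z 0‖ * ‖W 1‖ - ‖Z 1‖ * ‖W 0‖)]
  have h4 : (‖Z 0‖ ^ 2 + ‖Z 1‖ ^ 2) * (‖W 0‖ ^ 2 + ‖W 1‖ ^ 2) < ‖Z 2‖ ^ 2 * ‖W 2‖ ^ 2 :=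
    mul_lt_mul'' (by linarith) (by linarith) (by positivity) (by positivity)
  have h5 : (‖Z 2‖ * ‖W 2‖) ^ 2 ≤ (‖Z 0‖ * ‖W 0‖ + ‖Z 1‖ * ‖W 1‖) ^ 2 := by gcongr
  rw [mul_pow] at h5
  linarith

/-! ### Horospherical coordinates and the orbit form -/

/-- The denominator `⟨Z, q⟩` of the horospherical coordinates, where `q = (0, 1, -1)`
represents the fixed point of the Heisenberg group. -/
def hdenom (Z : Fin 3 → ℂ) : ℂ := Z 1 + Z 2

theorem hdenom_ne_zero {Z : Fin 3 → ℂ} (hZ : (herm Z Z).re < 0) : hdenom Z ≠ 0 := by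
  intro h
  rw [herm_self_re, eq_neg_of_add_eq_zero_left h, norm_neg] at hZ
  nlinarith [sq_nonneg ‖Z 0‖]

/-- The horizontal coordinate of the point represented by `Z`. -/
noncomputable def horiz (Z : Fin 3 → ℂ) : ℂ := Z 0 / hdenom Z

/-- The Hermitian form of two vectors, normalised so as to depend only on the points they
represent. -/
noncomputable def kernelForm (Z W : Fin 3 → ℂ) : ℂ := -herm Z W / (hdenom Z * conj (hdenom W))

theorem herm_heis_mulVec (p : Heis) {Z W : Fin 3 → ℂ} (hZ : hdenom Z ≠ 0) (hW : hdenom W ≠ 0) :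
    herm Z (p.mat *ᵥ W) = -(hdenom Z * conj (hdenom W)) *
      (kernelForm Z W - conj p.xi * horiz Z + p.xi * conj (horiz W) + conj p.half) := by
  have hW' : conj (hdenom W) ≠ 0 := by simpa using hW
  simp only [kernelForm, horiz, map_div₀]
  field_simp
  simp [herm, Heis.mat, hdenom, Matrix.mulVec, dotProduct, Fin.sum_univ_three]
  ring

/-- The squared modulus of the Hermitian product of a vector with an integral Heisenberg
translate of another one, in real coordinates. -/
def orbitForm (p R τ β m n : ℝ) : ℝ := ((p - m) ^ 2 + R) ^ 2 + (τ - m * β + n) ^ 2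

/-- The difference of the real parts of the horizontal coordinates. -/
noncomputable def coordP (Z W : Fin 3 → ℂ) : ℝ := (horiz Z).re - (horiz W).re

/-- The part of the Hermitian product which does not depend on `coordP`. -/
noncomputable def coordR (Z W : Fin 3 → ℂ) : ℝ := 2 * (kernelForm Z W).re - coordP Z W ^ 2

/-- The relative vertical coordinate. -/
noncomputable def coordT (Z W : Fin 3 → ℂ) : ℝ := 2 * (kernelForm Z W).im

/-- The sum of the imaginary parts of the horizontal coordinates, doubled. -/
noncomputable def coordB (Z W : Fin 3 → ℂ) : ℝ := 2 * ((horiz Z).im + (horiz W).im)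

/-- For real `ξ = m` the linear terms of `herm_heis_mulVec` combine to `-m * (horiz Z - conj (horiz
W))`. The conjugate makes the real parts subtract and the imaginary parts add, whence `coordP` and
`coordB`. Doubling and completing the square in `m` gives the form. -/
theorem norm_herm_heis_sq (m n : ℝ) {Z W : Fin 3 → ℂ} (hZ : hdenom Z ≠ 0) (hW : hdenom W ≠ 0) :
    ‖herm Z ((Heis.mk m n).mat *ᵥ W)‖ ^ 2 = (‖hdenom Z‖ * ‖hdenom W‖ / 2) ^ 2 *
      orbitForm (coordP Z W) (coordR Z W) (coordT Z W) (coordB Z W) m n := by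
  have hhalf : conj (Heis.mk m n).half = ((m ^ 2 / 2 : ℝ) : ℂ) + ((n / 2 : ℝ) : ℂ) * Complex.I := by
    simp only [Heis.half, map_div₀, map_sub, map_mul, Complex.conj_I,
      Complex.conj_ofReal, Complex.conj_ofNat]
    push_cast
    ring
  rw [herm_heis_mulVec _ hZ hW, hhalf, norm_mul, norm_neg, norm_mul, RCLike.norm_conj, mul_pow, div_pow,
    div_mul_eq_mul_div, mul_div_assoc]
  congr 1
  rw [← Complex.normSq_eq_norm_sq, Complex.normSq_apply]
  simp only [orbitForm, coordP, coordR, coordT, coordB, Complex.add_re, Complex.add_im,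
    Complex.sub_re, Complex.sub_im, Complex.mul_re, Complex.mul_im, Complex.ofReal_re,
    Complex.ofReal_im, Complex.conj_re, Complex.conj_im, Complex.I_re, Complex.I_im]
  ring

/-- Negativity of both vectors makes twice the real part of `kernelForm` exceed `‖horiz Z - horiz W‖
^ 2`, and `coordP ^ 2` is only the real part of that square. -/
theorem coordR_nonneg {Z W : Fin 3 → ℂ} (hZ : (herm Z Z).re < 0) (hW : (herm W W).re < 0) :
    0 ≤ coordR Z W := by
  -- Scaling to denominator `1` turns negativity into a lower bound for the real part of the last
  -- coordinate `r`, because `‖1 - r‖ ^ 2 - ‖r‖ ^ 2 = 1 - 2 * r.re`.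
  have normalise : ∀ {V : Fin 3 → ℂ}, (herm V V).re < 0 → ∃ r : ℂ,
      V = hdenom V • ![horiz V, 1 - r, r] ∧ ‖horiz V‖ ^ 2 + 1 < 2 * r.re := by
    intro V hV
    have h0 := hdenom_ne_zero hV
    have hV' : V = hdenom V • ![horiz V, 1 - V 2 / hdenom V, V 2 / hdenom V] := by
      funext i
      fin_cases i <;> simp [horiz, mul_div_cancel₀ _ h0, mul_sub]
      simp [hdenom]
    refine ⟨V 2 / hdenom V, hV', ?_⟩
    generalize V 2 / hdenom V = r at hV'
    generalize horiz V = z at hV' ⊢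
    have h1 : 0 < ‖hdenom V‖ ^ 2 := by positivity
    rw [hV', herm_smul_left, herm_smul_right, ← mul_assoc, Complex.mul_conj,
      Complex.re_ofReal_mul, Complex.normSq_eq_norm_sq] at hV
    have h2 := (pos_iff_neg_of_mul_neg hV).1 h1
    rw [herm_self_re] at h2
    simp only [Matrix.cons_val, ← Complex.normSq_eq_norm_sq, Complex.normSq_apply,
      Complex.sub_re, Complex.sub_im, Complex.one_re, Complex.one_im] at h2 ⊢
    linarith
  have hz := hdenom_ne_zero hZ
  have hw := hdenom_ne_zero hW
  obtain ⟨r, hr, hr'⟩ := normalise hZ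
  obtain ⟨s, hs, hs'⟩ := normalise hW
  have hE : kernelForm Z W = r + conj s - 1 - horiz Z * conj (horiz W) := by
    have hw' : conj (hdenom W) ≠ 0 := by simpa using hw
    have : herm Z W = hdenom Z * (conj (hdenom W) *
        herm ![horiz Z, 1 - r, r] ![horiz W, 1 - s, s]) := by
      rw [← herm_smul_right, ← herm_smul_left, ← hr, ← hs]
    rw [kernelForm, this]
    field_simp
    simp [herm]
    ring
  rw [coordR, coordP, hE]
  rw [← Complex.normSq_eq_norm_sq, Complex.normSq_apply] at hr' hs'
  simp
  nlinarith [sq_nonneg ((horiz Z).im - (horiz W).im)]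

/-! ### From distances to the orbit form -/

/-- The scalar that normalises the lift of `B • y` cancels between the numerator and the square
root. -/
theorem bergmanDist_smul (B : U21) (x y : CH2) :
    bergmanDist x (B • y) = 2 * Real.arcosh (‖herm x.lift (umat B *ᵥ y.lift)‖ /
      √((herm x.lift x.lift).re * (herm y.lift y.lift).re)) := by
  have h2 := coord_two_ne_zero (neg_mulVec B y)
  set c := ((umat B *ᵥ y.lift) 2)⁻¹ with hc
  have hc0 : c ≠ 0 := inv_ne_zero h2
  have hlift : (B • y).lift = c • (umat B *ᵥ y.lift) := CH2.lift_ofNeg _ _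
  have h3 : (herm (c • (umat B *ᵥ y.lift)) (c • (umat B *ᵥ y.lift))).re =
      ‖c‖ ^ 2 * (herm y.lift y.lift).re := by
    rw [herm_smul_left, herm_smul_right, ← mul_assoc, Complex.mul_conj, Complex.re_ofReal_mul,
      Complex.normSq_eq_norm_sq, herm_mulVec]
  rw [bergmanDist, hlift, h3, herm_smul_right, norm_mul, RCLike.norm_conj, mul_left_comm,
    Real.sqrt_mul (by positivity), Real.sqrt_sq (norm_nonneg _),
    mul_div_mul_left _ _ (norm_ne_zero_iff.2 hc0)]

theorem bergmanDist_smul_le_iff (B C : U21) (x y : CH2) :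
    bergmanDist x (B • y) ≤ bergmanDist x (C • y) ↔
      ‖herm x.lift (umat B *ᵥ y.lift)‖ ≤ ‖herm x.lift (umat C *ᵥ y.lift)‖ := by
  have hD : 0 < √((herm x.lift x.lift).re * (herm y.lift y.lift).re) :=
    Real.sqrt_pos.2 (mul_pos_of_neg_of_neg x.herm_lift_neg y.herm_lift_neg)
  have hB := norm_pos_iff.2 (herm_ne_zero x.herm_lift_neg (neg_mulVec B y))
  have hC := norm_pos_iff.2 (herm_ne_zero x.herm_lift_neg (neg_mulVec C y))
  rw [bergmanDist_smul, bergmanDist_smul, mul_le_mul_iff_right₀ two_pos,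
    Real.arcosh_le_arcosh (div_pos hB hD) (div_pos hC hD), div_le_div_iff_of_pos_right hD]

/-- The standard lift of a point, moved by the inverse of `A`. -/
noncomputable def pullLift (A : U21) (x : CH2) : Fin 3 → ℂ := umat A⁻¹ *ᵥ x.lift

theorem herm_pullLift_neg (A : U21) (x : CH2) :
    (herm (pullLift A x) (pullLift A x)).re < 0 := neg_mulVec A⁻¹ x

theorem herm_conj_mulVec (A B : U21) (x y : CH2) :
    herm x.lift (umat (A * B * A⁻¹) *ᵥ y.lift) =
      herm (pullLift A x) (umat B *ᵥ pullLift A y) := by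
  rw [← herm_mulVec A⁻¹, pullLift, pullLift, Matrix.mulVec_mulVec, Matrix.mulVec_mulVec,
    ← umat_mul, ← umat_mul]
  congr 3
  group

/-- The conjugate by `A` of the Heisenberg translation by `(m, n)`. -/
noncomputable def conjTranslation (A : U21) (m n : ℝ) : U21 := A * Heis.toU21 ⟨m, n⟩ * A⁻¹

theorem conjTranslation_zero (A : U21) : conjTranslation A 0 0 = 1 := by
  have : Heis.toU21 ⟨((0 : ℝ) : ℂ), 0⟩ = 1 := by
    rw [Complex.ofReal_zero, ← Heis.one_def, map_one]
  rw [conjTranslation, this, mul_one, mul_inv_cancel]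

/-- The squared modulus of the Hermitian product of lifts of `x` and of a translate of `y`, up to
a factor that does not depend on the translation. -/
noncomputable def orbitFun (A : U21) (x y : CH2) (m n : ℝ) : ℝ :=
  orbitForm (coordP (pullLift A x) (pullLift A y)) (coordR (pullLift A x) (pullLift A y))
    (coordT (pullLift A x) (pullLift A y)) (coordB (pullLift A x) (pullLift A y)) m n

theorem bergmanDist_conjTranslation_le_iff (A : U21) (x y : CH2) (m n m' n' : ℝ) :
    bergmanDist x (conjTranslation A m n • y) ≤ bergmanDist x (conjTranslation A m' n' • y) ↔
      orbitFun A x y m n ≤ orbitFun A x y m' n' := by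
  have hx := hdenom_ne_zero (herm_pullLift_neg A x)
  have hy := hdenom_ne_zero (herm_pullLift_neg A y)
  have hpos : 0 < (‖hdenom (pullLift A x)‖ * ‖hdenom (pullLift A y)‖ / 2) ^ 2 := by positivity
  have key : ∀ k l : ℝ, ‖herm (pullLift A x) (umat (Heis.toU21 ⟨k, l⟩) *ᵥ pullLift A y)‖ ^ 2 =
      (‖hdenom (pullLift A x)‖ * ‖hdenom (pullLift A y)‖ / 2) ^ 2 * orbitFun A x y k l :=
    fun k l => norm_herm_heis_sq k l hx hy
  rw [bergmanDist_smul_le_iff, conjTranslation, conjTranslation, herm_conj_mulVec,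
    herm_conj_mulVec, ← sq_le_sq₀ (norm_nonneg _) (norm_nonneg _), key, key,
    mul_le_mul_iff_right₀ hpos]

theorem bergmanDist_conjTranslation_eq_iff (A : U21) (x y : CH2) (m n m' n' : ℝ) :
    bergmanDist x (conjTranslation A m n • y) = bergmanDist x (conjTranslation A m' n' • y) ↔
      orbitFun A x y m n = orbitFun A x y m' n' := by
  simp only [le_antisymm_iff, bergmanDist_conjTranslation_le_iff]

theorem bergmanDist_le_conjTranslation_iff (A : U21) (x y : CH2) (m n : ℝ) :
    bergmanDist x y ≤ bergmanDist x (conjTranslation A m n • y) ↔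
      orbitFun A x y 0 0 ≤ orbitFun A x y m n := by
  have h := bergmanDist_conjTranslation_le_iff A x y 0 0 m n
  rwa [conjTranslation_zero, one_smul] at h

theorem mem_bisector_conjTranslation_iff (A : U21) (x y : CH2) (m n : ℝ) :
    x ∈ bisector y (conjTranslation A m n • y) ↔
      orbitFun A x y 0 0 = orbitFun A x y m n := by
  have h := bergmanDist_conjTranslation_eq_iff A x y 0 0 m n
  rwa [conjTranslation_zero, one_smul] at h

/-- The conjugate by `A` of the integer lattice. -/
noncomputable def conjLattice (A : U21) : Subgroup PU21 :=
  (integerLattice.map Heis.toPU21).map (MulAut.conj (QuotientGroup.mk A : PU21)).toMonoidHom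

theorem mem_conjLattice_iff (A : U21) (g : PU21) :
    g ∈ conjLattice A ↔
      ∃ m n : ℤ, g = (QuotientGroup.mk (conjTranslation A m n) : PU21) := by
  constructor
  · rintro ⟨_, ⟨_, ⟨m, n, rfl⟩, rfl⟩, rfl⟩
    exact ⟨m, n, by simp [conjTranslation, Heis.toPU21]⟩
  · rintro ⟨m, n, rfl⟩
    exact ⟨_, ⟨_, ⟨m, n, rfl⟩, rfl⟩, by simp [conjTranslation, Heis.toPU21]⟩

theorem mem_dirichlet_conjLattice_iff (A : U21) (x y : CH2) :
    x ∈ dirichlet (conjLattice A) y ↔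
      ∀ m n : ℤ, orbitFun A x y 0 0 ≤ orbitFun A x y m n := by
  simp only [← bergmanDist_le_conjTranslation_iff]
  constructor
  · intro h m n
    have := h _ ((mem_conjLattice_iff A _).2 ⟨m, n, rfl⟩)
    rwa [PU21.mk_smul] at this
  · intro h g hg
    obtain ⟨m, n, rfl⟩ := (mem_conjLattice_iff A _).1 hg
    rw [PU21.mk_smul]
    exact h m n

/-! ### Minimising the orbit form over the lattice -/

theorem sq_le_sub_intCast_sq {t : ℝ} (ht : |t| ≤ 1 / 2) (k : ℤ) : t ^ 2 ≤ (t - k) ^ 2 := by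
  rcases eq_or_ne k 0 with rfl | hk
  · simp
  · have h1 : (1 : ℝ) ≤ |(k : ℝ)| := by exact_mod_cast Int.one_le_abs hk
    have h2 := abs_sub_abs_le_abs_sub (k : ℝ) t
    rw [abs_sub_comm] at h2
    exact sq_le_sq.2 (by linarith)

/-- Near the locus `p = 1/2`, `τ = 0`, `β = n₀` the minimum of the form over the lattice is attained
at `(0, 0)` or at `(1, n₀)`. -/
theorem orbitForm_le {p R τ β : ℝ} {n₀ : ℤ} (hR : 0 ≤ R) (hp : |p - 1 / 2| < 1 / 4)
    (hτ : |τ| < 1 / 2) (hβ : |τ - β + n₀| < 1 / 2)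
    (h : orbitForm p R τ β 0 0 = orbitForm p R τ β 1 n₀) (m n : ℤ) :
    orbitForm p R τ β 0 0 ≤ orbitForm p R τ β m n := by
  obtain ⟨hp1, hp2⟩ := abs_lt.1 hp
  -- A gain of `1` inside the first square raises it by at least `1`, which outweighs `τ ^ 2`. The
  -- bounds `1/4 < p < 3/4` ensure this gain for `m ≤ -1` and `m ≥ 2`.
  have far : 1 ≤ (p - m) ^ 2 - p ^ 2 → orbitForm p R τ β 0 0 ≤ orbitForm p R τ β m n := by
    intro hm
    have h1 : τ ^ 2 ≤ 1 := (sq_le_one_iff_abs_le_one τ).2 (by linarith)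
    have h2 : (p ^ 2 + R + 1) ^ 2 ≤ ((p - m) ^ 2 + R) ^ 2 :=
      pow_le_pow_left₀ (by positivity) (by linarith) 2
    simp only [orbitForm]
    nlinarith [sq_nonneg (τ - m * β + n), sq_nonneg p]
  rcases lt_trichotomy m 0 with hm | rfl | hm
  · have hm' : (m : ℝ) ≤ -1 := by exact_mod_cast Int.le_sub_one_of_lt hm
    exact far (by nlinarith)
  · have := sq_le_sub_intCast_sq hτ.le (-n)
    push_cast at this
    simp only [orbitForm]
    push_cast
    linarith
  · rcases (Int.add_one_le_iff.2 hm).eq_or_lt with hm | hm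
    · obtain rfl : m = 1 := by omega
      have := sq_le_sub_intCast_sq hβ.le (n₀ - n)
      -- On the bisector the value at `(0, 0)` may be replaced by that at `(1, n₀)`, which is least
      -- in its column since its vertical offset is below `1/2`.
      rw [h]
      simp only [orbitForm]
      push_cast at this ⊢
      ring_nf at this ⊢
      linarith
    · have hm' : (2 : ℝ) ≤ m := by exact_mod_cast Int.add_one_le_iff.2 hm
      exact far (by nlinarith)

/-! ### Continuity of the coordinates and points with prescribed coordinates -/

theorem continuous_pullLift (A : U21) : Continuous (pullLift A) := by
  have h : ∀ i, Continuous fun x : CH2 => x.1 i := fun i =>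
    (EuclideanSpace.proj (𝕜 := ℂ) i).continuous.comp continuous_subtype_val
  have hl : Continuous CH2.lift := by
    refine continuous_pi fun i => ?_
    fin_cases i
    · exact h 0
    · exact h 1
    · exact continuous_const
  exact Continuous.matrix_mulVec continuous_const hl

theorem continuous_horiz_pullLift (A : U21) : Continuous fun x => horiz (pullLift A x) := by
  have h : ∀ i, Continuous fun x => pullLift A x i := fun i =>
    (continuous_apply i).comp (continuous_pullLift A)
  exact (h 0).div ((h 1).add (h 2)) fun x => hdenom_ne_zero (herm_pullLift_neg A x)

theorem continuous_kernelForm_pullLift (A : U21) (W : Fin 3 → ℂ) (hW : hdenom W ≠ 0) :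
    Continuous fun x => kernelForm (pullLift A x) W := by
  have h : ∀ i, Continuous fun x => pullLift A x i := fun i =>
    (continuous_apply i).comp (continuous_pullLift A)
  refine Continuous.div ?_ (((h 1).add (h 2)).mul continuous_const) fun x =>
    mul_ne_zero (hdenom_ne_zero (herm_pullLift_neg A x)) (by simpa using hW)
  exact ((((h 0).mul continuous_const).add ((h 1).mul continuous_const)).sub
    ((h 2).mul continuous_const)).neg

/-- There are points with relative vertical coordinate zero and prescribed horizontal
coordinates. -/
theorem exists_point (A : U21) (y : CH2) (p β : ℝ) : ∃ x : CH2,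
    coordP (pullLift A x) (pullLift A y) = p ∧ coordT (pullLift A x) (pullLift A y) = 0 ∧
      coordB (pullLift A x) (pullLift A y) = β := by
  set W := pullLift A y with hWdef
  have hW : hdenom W ≠ 0 := hdenom_ne_zero (herm_pullLift_neg A y)
  have hW' : conj (hdenom W) ≠ 0 := by simpa using hW
  -- `ζ` solves the conditions on `coordP` and `coordB`; `r₀` cancels everything in the kernel form
  -- but the real number `K`, so `coordT` vanishes; a large `K` makes `V` negative.
  set ζ : ℂ := ⟨(horiz W).re + p, β / 2 - (horiz W).im⟩ with hζ
  set σ : ℂ := W 2 / hdenom W with hσ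
  set r₀ : ℂ := 1 - conj σ + ζ * conj (horiz W) with hr₀
  obtain ⟨K, hK⟩ : ∃ K : ℝ, ‖ζ‖ ^ 2 + 1 - 2 * r₀.re < 2 * K :=
    ⟨(‖ζ‖ ^ 2 + 1 - 2 * r₀.re) / 2 + 1, by linarith⟩
  set V : Fin 3 → ℂ := ![ζ, 1 - (r₀ + K), r₀ + K] with hVdef
  have hV : (herm V V).re < 0 := by
    rw [herm_self_re]
    simp only [hVdef, Matrix.cons_val]
    rw [← Complex.normSq_eq_norm_sq (1 - _), ← Complex.normSq_eq_norm_sq (_ + _),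
      Complex.normSq_apply, Complex.normSq_apply]
    simp only [Complex.sub_re, Complex.sub_im, Complex.one_re, Complex.one_im, Complex.add_re,
      Complex.add_im, Complex.ofReal_re, Complex.ofReal_im]
    linarith
  have hV1 : hdenom V = 1 := by simp [hdenom, hVdef]
  obtain ⟨c, hc, hx⟩ : ∃ c : ℂ, c ≠ 0 ∧ pullLift A (A • CH2.ofNeg V hV) = c • V := by
    have h2 := coord_two_ne_zero (neg_mulVec A (CH2.ofNeg V hV))
    refine ⟨((umat A *ᵥ (CH2.ofNeg V hV).lift) 2)⁻¹ * (V 2)⁻¹,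
      mul_ne_zero (inv_ne_zero h2) (inv_ne_zero (coord_two_ne_zero hV)), ?_⟩
    rw [pullLift, U21.smul_def, CH2.lift_ofNeg, Matrix.mulVec_smul, Matrix.mulVec_mulVec,
      ← umat_mul, inv_mul_cancel, umat_one, Matrix.one_mulVec, CH2.lift_ofNeg, smul_smul]
  have hden : hdenom (c • V) = c := by
    rw [show hdenom (c • V) = c * hdenom V by simp [hdenom, mul_add], hV1, mul_one]
  have hhor : horiz (c • V) = ζ := by
    rw [horiz, hden]
    simp [hVdef, mul_div_cancel_left₀ _ hc]
  have hker : kernelForm (c • V) W = K := by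
    have h1 : W 1 = hdenom W - W 2 := by simp [hdenom]
    rw [kernelForm, hden, herm_smul_left, div_eq_iff (mul_ne_zero hc hW')]
    simp only [herm, hVdef, h1, hr₀, hσ, horiz, map_div₀, map_sub, Matrix.cons_val]
    field_simp
    ring
  refine ⟨A • CH2.ofNeg V hV, ?_⟩
  rw [hx]
  refine ⟨?_, ?_, ?_⟩
  · rw [coordP, hhor]
    simp [hζ]
  · rw [coordT, hker]
    simp
  · rw [coordB, hhor]
    simp [hζ]
    ring

/-! ### Infinitely many sides -/

/-- For every integer `n` there is a point whose distance to `y` is its distance to the translate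
of `y` by `(1, n)`, but not its distance to any other translate by `(1, k)`, and near which the
bisector of these two points lies in the Dirichlet polyhedron. -/
theorem exists_side_point (A : U21) (y : CH2) (n : ℤ) : ∃ x : CH2,
    (∀ k : ℤ, x ∈ bisector y (conjTranslation A 1 k • y) ↔ k = n) ∧
    ∃ U : Set CH2, IsOpen U ∧ x ∈ U ∧
      U ∩ bisector y (conjTranslation A 1 n • y) ⊆ dirichlet (conjLattice A) y := by
  set W := pullLift A y with hW
  have hW0 : hdenom W ≠ 0 := hdenom_ne_zero (herm_pullLift_neg A y)
  obtain ⟨x, hp, ht, hb⟩ := exists_point A y (1 / 2) n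
  have hcp : Continuous fun z => coordP (pullLift A z) W :=
    (Complex.continuous_re.comp (continuous_horiz_pullLift A)).sub continuous_const
  have hcb : Continuous fun z => coordB (pullLift A z) W :=
    continuous_const.mul
      ((Complex.continuous_im.comp (continuous_horiz_pullLift A)).add continuous_const)
  have hct : Continuous fun z => coordT (pullLift A z) W :=
    continuous_const.mul
      (Complex.continuous_im.comp (continuous_kernelForm_pullLift A W hW0))
  refine ⟨x, fun k => ?_, {z | |coordP (pullLift A z) W - 1 / 2| < 1 / 4} ∩
    {z | |coordT (pullLift A z) W| < 1 / 2} ∩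
    {z | |coordT (pullLift A z) W - coordB (pullLift A z) W + n| < 1 / 2}, ?_, ?_, ?_⟩
  · rw [mem_bisector_conjTranslation_iff, orbitFun, orbitFun, hp, ht, hb, orbitForm, orbitForm]
    constructor
    · intro h
      -- At `p = 1/2` the first squares agree, so only the vertical offset `k - n` remains.
      have h1 : ((k : ℝ) - n) ^ 2 = 0 := by linarith
      exact_mod_cast sub_eq_zero.1 (pow_eq_zero_iff two_ne_zero |>.1 h1)
    · rintro rfl
      ring
  · exact ((isOpen_lt (hcp.sub continuous_const).abs continuous_const).inter
      (isOpen_lt hct.abs continuous_const)).inter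
      (isOpen_lt ((hct.sub hcb).add continuous_const).abs continuous_const)
  · simp only [Set.mem_inter_iff, Set.mem_ofPred_eq, hW, hp, ht, hb]
    norm_num
  · rintro z ⟨⟨⟨h1, h2⟩, h3⟩, h4⟩
    rw [mem_bisector_conjTranslation_iff] at h4
    rw [mem_dirichlet_conjLattice_iff]
    exact orbitForm_le (coordR_nonneg (herm_pullLift_neg A z) (herm_pullLift_neg A y)) h1 h2 h3 h4

theorem infinite_sides_conjLattice (A : U21) (y : CH2) :
    {S : Set CH2 | IsSide (conjLattice A) y S}.Infinite := by
  choose x hx U hU hxU hUD using exists_side_point A y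
  refine Set.infinite_of_injective_forall_mem
    (f := fun n : ℤ => dirichlet (conjLattice A) y ∩ bisector y (conjTranslation A 1 n • y)) ?_ ?_
  · intro n k hnk
    have h1 : x n ∈ bisector y (conjTranslation A 1 n • y) := (hx n n).2 rfl
    have h2 : x n ∈ dirichlet (conjLattice A) y ∩ bisector y (conjTranslation A 1 n • y) :=
      ⟨hUD n ⟨hxU n, h1⟩, h1⟩
    -- Equal sides would put `x n` on the bisector for `k`, which forces `k = n`.
    rw [show dirichlet (conjLattice A) y ∩ bisector y (conjTranslation A 1 n • y) = _ from hnk]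
      at h2
    exact ((hx n k).1 h2.2).symm
  · intro n
    refine ⟨QuotientGroup.mk (conjTranslation A 1 n),
      (mem_conjLattice_iff A _).2 ⟨1, n, by simp⟩, ?_, rfl, U n, hU n,
      ⟨x n, hxU n, (hx n n).2 rfl⟩, fun z hz => ⟨hUD n hz, hz.2⟩⟩
    -- If the translate fixed `y`, its bisector would be the whole ball and contain `x (n + 1)`.
    intro hfix
    rw [PU21.mk_smul] at hfix
    have h : x (n + 1) ∈ bisector y (conjTranslation A 1 n • y) := by
      rw [hfix]
      rfl
    have := (hx (n + 1) n).1 h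
    omega

end CHyp

theorem theorem3p2 (G : Subgroup CHyp.PU21)
    (hG : ∃ h : CHyp.PU21,
      G = (CHyp.integerLattice.map CHyp.Heis.toPU21).map (MulAut.conj h).toMonoidHom)
    (y : CHyp.CH2) :
    {S : Set CHyp.CH2 | CHyp.IsSide G y S}.Infinite := by
  obtain ⟨h, rfl⟩ := hG
  obtain ⟨A, rfl⟩ := QuotientGroup.mk_surjective h
  exact CHyp.infinite_sides_conjLattice A y
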